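/- Let $n\ge 0$, let $-1<y_1<\dots<y_n<1$ and $g_1,\dots,g_n>0$, and consider the discrete dual cubic string with mass distribution $g=\sum_{k=1}^n g_k\delta_{y_k}$, i.e. for $\lambda\in\mathbb C$ the system $$\partial_y\phi_1=g\,\phi_2,\qquad \partial_y\phi_2=g\,\phi_3,\qquad \partial_y\phi_3=-\lambda\,\phi_1\qquad(-1<y<1),$$ for complex-valued $\Phi=(\phi_1,\phi_2,\phi_3)$, with boundary conditions $\phi_2(-1)=\phi_3(-1)=0$ and $\phi_3(1)=0$. Here the system means: off the points $y_k$ one has $\phi_1'=\phi_2'=0$ and $\phi_3'=-\lambda\phi_1$; $\phi_3$ is continuous; and at each $y_k$ the one-sided limits of $\phi_1,\phi_2$ exist and satisfy $$\phi_1(y_k^+)-\phi_1(y_k^-)=g_k\,\frac{\phi_2(y_k^-)+\phi_2(y_k^+)}{2},\qquad \phi_2(y_k^+)-\phi_2(y_k^-)=g_k\,\phi_3(y_k).$$ The values at $\pm1$ are the limits from inside the interval, and the values of $\phi_1,\phi_2$ at the points $y_k$ themselves are disregarded. The spectrum is the set of $\lambda\in\mathbb C$ for which the boundary value problem has a nontrivial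 solution (an eigenfunction). Then for every $\lambda\in\mathbb C$ there is a unique solution $\Phi(y;\lambda)$ of the system with $\Phi(-1;\lambda)=(1,0,0)$. Define the Weyl functions $$W(\lambda)=-\frac{\phi_2(1;\lambda)}{\phi_3(1;\lambda)},\qquad Z(\lambda)=-\frac{\phi_1(1;\lambda)}{\phi_3(1;\lambda)}.$$ The following hold. 1. The spectrum consists of $n+1$ real numbers $0=\lambda_0<\lambda_1<\dots<\lambda_n$, and it is simple: every eigenfunction for $\lambda_j$ is a scalar multiple of $\Phi(\cdot;\lambda_j)$, and each $\lambda_j$ is a simple zero of $\lambda\mapsto\phi_3(1;\lambda)$. 2. There are real numbers $b_k>0$ and $c_k>0$ $(1\le k\le n)$ such that, for all $\lambda$ outside the spectrum, $$W(\lambda)=\sum_{k=1}^n\frac{b_k}{\lambda-\lambda_k},\qquad Z(\lambda)=\frac1{2\lambda}+\sum_{k=1}^n\frac{c_k}{\lambda-\lambda_k},$$ and $$c_k=\sum_{m=1}^n\frac{b_m b_k}{\lambda_m+\lambda_k}\qquad(1\le k\le n).$$ 3. $Z(\lambda)+Z(-\lambda)+W(\lambda)W(-\lambda)=0$ whenever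 neither $\lambda$ nor $-\lambda$ lies in the spectrum. 4. $Z$ is uniquely determined by $W$: if two discrete dual cubic strings with positive masses (possibly with different numbers of masses) have Weyl functions $W$ that agree outside the union of their spectra, then their Weyl functions $Z$ agree there as well. -/

import Mathlib

open Filter Topology Set

/-- A discrete dual cubic string on the interval `-1 < y < 1`: the measure
`g = ∑ k, g k • δ_(y k)` with `n` point masses at positions `-1 < y 0 < ⋯ < y (n - 1) < 1`.
No sign is imposed on the masses here. -/
structure DualCubicString (n : ℕ) where
  /-- positions of the point masses -/
  y : Fin n → ℝ
  /-- the point masses -/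
  g : Fin n → ℝ
  y_strictMono : StrictMono y
  neg_one_lt_y : ∀ k, -1 < y k
  y_lt_one : ∀ k, y k < 1

namespace DualCubicString

variable {n : ℕ} (S : DualCubicString n)

/-- `Φ = (φ₁, φ₂, φ₃)` (components numbered `0, 1, 2`) solves the system
`φ₁' = g φ₂`, `φ₂' = g φ₃`, `φ₃' = -lam φ₁` on `[-1, 1]`, where `g = ∑ k, g k • δ_(y k)`.
Away from the masses the system reads `φ₁' = 0`, `φ₂' = 0`, `φ₃' = -lam φ₁`. At a mass, `φ₃` is
continuous, `φ₁` and `φ₂` have one-sided limits, and the product `φ₂ δ_(y k)` is read as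
`⟨φ₂(y k)⟩ δ_(y k)`, where `⟨ ⟩` is the average of the two one-sided limits.
The values at `±1` are the limits from inside the interval. The values of `φ₁` and `φ₂`
exactly at the masses, and of `Φ` outside `[-1, 1]`, are irrelevant. -/
structure IsSolution (lam : ℂ) (Φ : ℝ → Fin 3 → ℂ) : Prop where
  hasDerivAt_one : ∀ y ∈ Ioo (-1 : ℝ) 1, y ∉ range S.y →
    HasDerivAt (fun t => Φ t 0) 0 y
  hasDerivAt_two : ∀ y ∈ Ioo (-1 : ℝ) 1, y ∉ range S.y →
    HasDerivAt (fun t => Φ t 1) 0 y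
  hasDerivAt_three : ∀ y ∈ Ioo (-1 : ℝ) 1, y ∉ range S.y →
    HasDerivAt (fun t => Φ t 2) (-lam * Φ y 0) y
  continuousAt_three : ∀ k, ContinuousAt (fun t => Φ t 2) (S.y k)
  jump : ∀ k, ∃ p₁ q₁ p₂ q₂ : ℂ,
    Tendsto (fun t => Φ t 0) (𝓝[<] S.y k) (𝓝 p₁) ∧
    Tendsto (fun t => Φ t 0) (𝓝[>] S.y k) (𝓝 q₁) ∧
    Tendsto (fun t => Φ t 1) (𝓝[<] S.y k) (𝓝 p₂) ∧
    Tendsto (fun t => Φ t 1) (𝓝[>] S.y k) (𝓝 q₂) ∧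
    q₁ - p₁ = (S.g k : ℂ) * ((p₂ + q₂) / 2) ∧
    q₂ - p₂ = (S.g k : ℂ) * Φ (S.y k) 2
  continuous_left : ContinuousWithinAt Φ (Ici (-1)) (-1)
  continuous_right : ContinuousWithinAt Φ (Iic 1) 1

/-- A nontrivial solution (nonzero somewhere off the masses) with the boundary conditions
`φ₂(-1) = φ₃(-1) = 0`, `φ₃(1) = 0`. -/
def IsEigenfunction (lam : ℂ) (Φ : ℝ → Fin 3 → ℂ) : Prop :=
  S.IsSolution lam Φ ∧ Φ (-1) 1 = 0 ∧ Φ (-1) 2 = 0 ∧ Φ 1 2 = 0 ∧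
    ∃ y ∈ Icc (-1 : ℝ) 1, y ∉ range S.y ∧ Φ y ≠ 0

/-- The spectrum: the set of (complex) eigenvalues of the boundary value problem. -/
def spectrum : Set ℂ := {lam | ∃ Φ, S.IsEigenfunction lam Φ}

/-- A solution with the initial value `Φ(-1) = (1, 0, 0)`. -/
def IsNormalizedSolution (lam : ℂ) (Φ : ℝ → Fin 3 → ℂ) : Prop :=
  S.IsSolution lam Φ ∧ Φ (-1) = ![1, 0, 0]

/-- `S.phi lam y = Φ(y; lam)`, the solution with `Φ(-1; lam) = (1, 0, 0)`. -/
noncomputable def phi (lam : ℂ) : ℝ → Fin 3 → ℂ :=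
  Classical.epsilon (S.IsNormalizedSolution lam)

/-- The first Weyl function `W = -φ₂(1; lam) / φ₃(1; lam)`. -/
noncomputable def weylW (lam : ℂ) : ℂ := -(S.phi lam 1 1 / S.phi lam 1 2)

/-- The second Weyl function `Z = -φ₁(1; lam) / φ₃(1; lam)`. -/
noncomputable def weylZ (lam : ℂ) : ℂ := -(S.phi lam 1 0 / S.phi lam 1 2)

end DualCubicString

/-! A solution is a product of elementary maps: a drift by `l` adds `l * x * v 0` to the third
component (`x = -lam`), and averaging `φ₂` at a mass `g` gives the unipotent jump with entries `g`
and `g ^ 2 / 2`. Over a general commutative ℝ-algebra these maps serve for complex values, real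
values and polynomials in `x` alike.

Two invariants carry the proof. The first is a set of sign conditions, `Interlaced`, for an
alternating form `B` with `0 ≤ B f (x * f)`. For `imForm` it forces the zeros of `φ₃(1)` to be real;
for `wronskianForm` it makes them simple and the residues of `Z` positive. A degree count and
positivity for `x > 0` then give `n + 1` zeros, the least of them `lam = 0`. The second is the
identity `leftState_neg` between the solutions for `x` and `-x`. Divided by the product of the `φ₃`
it is the relation between `Z` and `W`; at an eigenvalue it gives `c_k = -b_k W(-λ_k)`, hence the
sign of `b_k` and the formula for `c_k`. If two strings share `W`, the relation makes the difference
of their `Z` odd. Its poles are all positive, since `1 / (2 * lam)` cancels, and it vanishes at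
infinity, so it is zero. -/

/-! ### Transfer maps and the sign conditions they preserve. -/

/-- The value of a solution after a mass-free interval of length `l`, where `x = -lam`. -/
def drift {R : Type*} [CommRing R] [Algebra ℝ R] (x : R) (l : ℝ) (v : Fin 3 → R) : Fin 3 → R :=
  ![v 0, v 1, v 2 + l • (x * v 0)]

/-- The value of a solution after crossing a mass `g`. -/
noncomputable def massJump {R : Type*} [CommRing R] [Algebra ℝ R] (g : ℝ) (v : Fin 3 → R) : Fin 3 → R :=
  ![v 0 + g • v 1 + (g ^ 2 / 2) • v 2, v 1 + g • v 2, v 2]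

section Transfer

variable {R : Type*} [CommRing R] [Algebra ℝ R]

@[simp] lemma drift_zero (x : R) (l : ℝ) (v : Fin 3 → R) : drift x l v 0 = v 0 := rfl
@[simp] lemma drift_one (x : R) (l : ℝ) (v : Fin 3 → R) : drift x l v 1 = v 1 := rfl
@[simp] lemma drift_two (x : R) (l : ℝ) (v : Fin 3 → R) :
    drift x l v 2 = v 2 + l • (x * v 0) := rfl
@[simp] lemma massJump_zero (g : ℝ) (v : Fin 3 → R) :
    massJump g v 0 = v 0 + g • v 1 + (g ^ 2 / 2) • v 2 := rfl
@[simp] lemma massJump_one (g : ℝ) (v : Fin 3 → R) : massJump g v 1 = v 1 + g • v 2 := rfl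
@[simp] lemma massJump_two (g : ℝ) (v : Fin 3 → R) : massJump g v 2 = v 2 := rfl

lemma drift_smul (x a : R) (l : ℝ) (v : Fin 3 → R) : drift x l (a • v) = a • drift x l v := by
  funext i
  fin_cases i <;> simp [Algebra.smul_def]
  ring

lemma massJump_smul (a : R) (g : ℝ) (v : Fin 3 → R) : massJump g (a • v) = a • massJump g v := by
  funext i
  fin_cases i <;> simp [Algebra.smul_def] <;> ring

variable {R' : Type*} [CommRing R'] [Algebra ℝ R']

lemma map_drift (f : R →ₐ[ℝ] R') (x : R) (l : ℝ) (v : Fin 3 → R) :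
    (fun i => f (drift x l v i)) = drift (f x) l (fun i => f (v i)) := by
  funext i
  fin_cases i <;> simp

lemma map_massJump (f : R →ₐ[ℝ] R') (g : ℝ) (v : Fin 3 → R) :
    (fun i => f (massJump g v i)) = massJump g (fun i => f (v i)) := by
  funext i
  fin_cases i <;> simp

/-- The sign conditions, with respect to an alternating form `B`, satisfied by the three
components of a solution. -/
structure Interlaced (B : R →ₗ[ℝ] R →ₗ[ℝ] ℝ) (x : R) (c : ℝ) (v : Fin 3 → R) : Prop where
  zero_one : 0 ≤ B (v 0) (v 1)
  zero_two : c ≤ B (v 0) (v 2)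
  one_two : 0 ≤ B (v 1) (v 2)
  one_zero : 0 ≤ B (v 1) (x * v 0)
  two_zero : 0 ≤ B (v 2) (x * v 0)
  two_one : 0 ≤ B (v 2) (x * v 1)

variable {B : R →ₗ[ℝ] R →ₗ[ℝ] ℝ} {x : R} {κ : ℝ}

/-- Only `v 2` moves, by `l • (x * v 0)`. Each pairing with `v 2` gains a multiple of another
pairing in the list, of `B (v 0) (x * v 0)`, or of `B (x * v 0) (x * v 0) = 0`; this is why the list
has these six entries. -/
lemma Interlaced.drift {c : ℝ} {v : Fin 3 → R} (h : Interlaced B x c v) (hB : ∀ f, B f f = 0)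
    (hκ : 0 ≤ κ) (hx : ∀ f g, B (x * f) (x * g) = κ * B f g) {l : ℝ} (hl : 0 ≤ l) :
    Interlaced B x (c + l * B (v 0) (x * v 0)) (drift x l v) where
  zero_one := h.zero_one
  zero_two := by simpa using h.zero_two
  one_two := by simpa using add_nonneg h.one_two (mul_nonneg hl h.one_zero)
  one_zero := h.one_zero
  two_zero := by simpa [hB] using h.two_zero
  two_one := by
    simpa [hx] using add_nonneg h.two_one (mul_nonneg hl (mul_nonneg hκ h.zero_one))

lemma Interlaced.mono {c c' : ℝ} {v : Fin 3 → R} (h : Interlaced B x c v) (hc : c' ≤ c) :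
    Interlaced B x c' v :=
  { h with zero_two := hc.trans h.zero_two }

lemma Interlaced.massJump {c : ℝ} {v : Fin 3 → R} (h : Interlaced B x c v) (hc : 0 ≤ c)
    (hB : ∀ f, B f f = 0) (hpos : ∀ f, 0 ≤ B f (x * f)) {g : ℝ} (hg : 0 ≤ g) :
    Interlaced B x c (massJump g v) := by
  have hskew : ∀ f f', B f f' = -B f' f := fun f f' => by
    have := hB (f + f')
    simp only [map_add, LinearMap.add_apply, hB] at this
    linarith
  obtain ⟨h01, h02, h12, h10, h20, h21⟩ := h
  have h02' := hc.trans h02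
  refine ⟨?_, ?_, ?_, ?_, ?_, ?_⟩
  · simp only [massJump_zero, massJump_one, map_add, map_smul, LinearMap.add_apply,
      LinearMap.smul_apply, smul_eq_mul, hB, hskew (v 2) (v 1)]
    nlinarith [mul_nonneg hg h02', mul_nonneg (sq_nonneg g) h12]
  · simp only [massJump_zero, massJump_two, map_add, map_smul, LinearMap.add_apply,
      LinearMap.smul_apply, smul_eq_mul, hB]
    nlinarith [mul_nonneg hg h12]
  · simpa [hB] using h12
  -- The cross term `B (v 1) (x * v 2)` has no known sign. It is absorbed by positivity at `v 1 + (g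
  -- / 2) • v 2`, the average of the second component across the mass.
  · have hq := hpos (v 1 + (g / 2) • v 2)
    have h2 := hpos (v 2)
    simp only [massJump_zero, massJump_one, mul_add, map_add, map_smul, LinearMap.add_apply,
      LinearMap.smul_apply, smul_eq_mul, mul_smul_comm] at hq ⊢
    nlinarith [mul_nonneg hg hq, mul_nonneg hg h20, mul_nonneg (sq_nonneg g) h21,
      mul_nonneg (pow_nonneg hg 3) h2]
  · have h2 := hpos (v 2)
    simp only [massJump_zero, massJump_two, mul_add, map_add, map_smul, smul_eq_mul,
      mul_smul_comm]
    nlinarith [mul_nonneg hg h21, mul_nonneg (sq_nonneg g) h2]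
  · have h2 := hpos (v 2)
    simp only [massJump_one, massJump_two, mul_add, map_add, map_smul, smul_eq_mul,
      mul_smul_comm]
    nlinarith [mul_nonneg hg h2]

end Transfer

/-! ### States at the nodes and their invariants. -/

namespace DualCubicString

variable {n : ℕ} (S : DualCubicString n)

/-- The points `-1, y 0, …, y (n - 1), 1`, continued by `1`. -/
noncomputable def node : ℕ → ℝ
  | 0 => -1
  | k + 1 => if h : k < n then S.y ⟨k, h⟩ else 1

/-- The masses, continued by `0`. -/
noncomputable def mass (k : ℕ) : ℝ := if h : k < n then S.g ⟨k, h⟩ else 0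

/-- The distance between consecutive nodes. -/
noncomputable def gap (k : ℕ) : ℝ := S.node (k + 1) - S.node k

lemma node_zero : S.node 0 = -1 := rfl

lemma node_succ {k : ℕ} (h : k < n) : S.node (k + 1) = S.y ⟨k, h⟩ := by simp [node, h]

lemma node_last : S.node (n + 1) = 1 := by simp [node]

lemma node_lt_succ {k : ℕ} (hk : k ≤ n) : S.node k < S.node (k + 1) := by
  rcases hk.lt_or_eq with h | rfl
  · rw [S.node_succ h]
    cases k with
    | zero => exact S.neg_one_lt_y _
    | succ k =>
      rw [S.node_succ (by omega)]
      exact S.y_strictMono (by simp)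
  · rw [S.node_last]
    cases k with
    | zero => simp [node_zero]
    | succ k =>
      rw [S.node_succ (by omega)]
      exact S.y_lt_one _

lemma node_monotone : Monotone S.node := by
  refine monotone_nat_of_le_succ fun k => ?_
  by_cases hk : k ≤ n
  · exact (S.node_lt_succ hk).le
  · obtain ⟨m, rfl⟩ : ∃ m, k = m + 1 := ⟨k - 1, by omega⟩
    simp [node, show ¬ m < n by omega, show ¬ m + 1 < n by omega]

lemma gap_nonneg (k : ℕ) : 0 ≤ S.gap k := sub_nonneg.2 (S.node_monotone k.le_succ)

lemma gap_pos {k : ℕ} (hk : k ≤ n) : 0 < S.gap k := sub_pos.2 (S.node_lt_succ hk)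

lemma mass_nonneg (hg : ∀ k, 0 < S.g k) (k : ℕ) : 0 ≤ S.mass k := by
  unfold mass
  split
  · exact (hg _).le
  · exact le_rfl

lemma mass_pos (hg : ∀ k, 0 < S.g k) {k : ℕ} (hk : k < n) : 0 < S.mass k := by
  simp [mass, hk, hg]

section Ring

variable {R : Type*} [CommRing R] [Algebra ℝ R]

/-- The right limit at the `k`-th node of the solution with initial value `v`,
where `x = -lam`. -/
noncomputable def state (x : R) (v : Fin 3 → R) : ℕ → Fin 3 → R
  | 0 => v
  | k + 1 => massJump (S.mass k) (drift x (S.gap k) (state x v k))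

/-- The left limit at the node `k + 1` of the solution with initial value `(1, 0, 0)`,
where `x = -lam`. -/
noncomputable def leftState (x : R) (k : ℕ) : Fin 3 → R :=
  drift x (S.gap k) (S.state x ![1, 0, 0] k)

lemma state_smul (x a : R) (v : Fin 3 → R) (k : ℕ) :
    S.state x (a • v) k = a • S.state x v k := by
  induction k with
  | zero => rfl
  | succ k ih => simp only [state, ih, drift_smul, massJump_smul]

lemma leftState_zero (x : R) : S.leftState x 0 = drift x (S.gap 0) ![1, 0, 0] := rfl

lemma leftState_succ (x : R) (k : ℕ) :
    S.leftState x (k + 1) = drift x (S.gap (k + 1)) (massJump (S.mass k) (S.leftState x k)) := rfl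

lemma map_leftState {R' : Type*} [CommRing R'] [Algebra ℝ R'] (f : R →ₐ[ℝ] R') (x : R) (k : ℕ) :
    (fun i => f (S.leftState x k i)) = S.leftState (f x) k := by
  induction k with
  | zero =>
    rw [leftState_zero, map_drift, leftState_zero]
    congr 1
    funext i
    fin_cases i <;> simp
  | succ k ih => rw [leftState_succ, map_drift, map_massJump, ih, leftState_succ]

/-- The vector `(1, 0, 0)` satisfies the conditions with bound `0`, the first drift raises the bound
to `S.gap 0 * B 1 x`, and no later map lowers it. -/
lemma interlaced_leftState (hg : ∀ k, 0 < S.g k) {B : R →ₗ[ℝ] R →ₗ[ℝ] ℝ} {x : R} {κ : ℝ}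
    (hB : ∀ f, B f f = 0) (hκ : 0 ≤ κ) (hx : ∀ f g, B (x * f) (x * g) = κ * B f g)
    (hpos : ∀ f, 0 ≤ B f (x * f)) (k : ℕ) :
    Interlaced B x (S.gap 0 * B 1 x) (S.leftState x k) := by
  have h1 := hpos 1
  induction k with
  | zero =>
    have h : Interlaced B x 0 ![1, 0, 0] := by constructor <;> simp
    simpa [leftState_zero] using h.drift hB hκ hx (S.gap_nonneg 0)
  | succ k ih =>
    rw [mul_one] at h1
    refine ((ih.massJump (mul_nonneg (S.gap_nonneg 0) h1) hB hpos (S.mass_nonneg hg k)).drift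
      hB hκ hx (S.gap_nonneg _)).mono ?_
    exact le_add_of_nonneg_right (mul_nonneg (S.gap_nonneg _) (hpos _))

/-- The pairing `v 0 * w 2 + v 2 * w 0 - v 1 * w 1` of the solutions for `x` and `-x` is conserved:
drift contributions cancel by the opposite signs of `x`, and mass jumps preserve it because the
corner entry is exactly `g ^ 2 / 2`. It starts at `0`. -/
lemma leftState_neg (x : R) (k : ℕ) :
    S.leftState x k 0 * S.leftState (-x) k 2 + S.leftState x k 2 * S.leftState (-x) k 0 =
      S.leftState x k 1 * S.leftState (-x) k 1 := by
  induction k with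
  | zero => simp [leftState_zero]
  | succ k ih =>
    have h2 : algebraMap ℝ R (S.mass k ^ 2 / 2) * 2 = algebraMap ℝ R (S.mass k) ^ 2 := by
      rw [← map_pow, ← map_ofNat (algebraMap ℝ R) 2, ← map_mul]
      congr 1
      ring
    simp only [leftState_succ, drift_zero, drift_one, drift_two, massJump_zero, massJump_one,
      massJump_two, Algebra.smul_def]
    linear_combination ih + S.leftState x k 2 * S.leftState (-x) k 2 * h2

end Ring

end DualCubicString

/-! ### The two alternating forms. -/

open Polynomial ComplexConjugate in
/-- The alternating form `im (conj f * g)` on `ℂ`, scaled by `im z`. -/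
noncomputable def imForm (z : ℂ) : ℂ →ₗ[ℝ] ℂ →ₗ[ℝ] ℝ :=
  LinearMap.mk₂ ℝ (fun f g => z.im * (conj f * g).im)
    (fun _ _ _ => by simp; ring) (fun _ _ _ => by simp; ring)
    (fun _ _ _ => by simp; ring) (fun _ _ _ => by simp; ring)

open Polynomial in
/-- The Wronskian of two real polynomials at the point `t`. -/
noncomputable def wronskianForm (t : ℝ) : ℝ[X] →ₗ[ℝ] ℝ[X] →ₗ[ℝ] ℝ :=
  LinearMap.mk₂ ℝ (fun f g => f.eval t * (derivative g).eval t - (derivative f).eval t * g.eval t)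
    (fun _ _ _ => by simp; ring) (fun _ _ _ => by simp; ring)
    (fun _ _ _ => by simp; ring) (fun _ _ _ => by simp; ring)

/-! ### End values as polynomials in `-lam`, and their zeros. -/

namespace DualCubicString

open Polynomial

variable {n : ℕ} (S : DualCubicString n)

/-- The components of the normalized solution at `y = 1`, as polynomials in `-lam`. -/
noncomputable def endPoly (i : Fin 3) : ℝ[X] := S.leftState X n i

lemma aeval_endPoly {R : Type*} [CommRing R] [Algebra ℝ R] (z : R) (i : Fin 3) :
    aeval z (S.endPoly i) = S.leftState z n i := by
  rw [← aeval_X (R := ℝ) z, ← S.map_leftState (aeval z) X n, aeval_X, endPoly]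

lemma eval_endPoly (t : ℝ) (i : Fin 3) : (S.endPoly i).eval t = S.leftState t n i := by
  rw [← aeval_endPoly, coe_aeval_eq_eval]

/-- For `imForm z` the lower bound is `S.gap 0 * z.im ^ 2`, while a vanishing third component makes
the bounded quantity `0`. -/
lemma im_eq_zero_of_leftState_eq_zero (hg : ∀ k, 0 < S.g k) {z : ℂ}
    (hz : S.leftState z n 2 = 0) : z.im = 0 := by
  by_contra h
  have key := (S.interlaced_leftState hg (B := imForm z) (x := z) (κ := Complex.normSq z)
    (fun f => by simp [imForm]; right; ring) (Complex.normSq_nonneg z)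
    (fun f g => by simp [imForm, Complex.normSq_apply]; ring)
    (fun f => by
      simp only [imForm, LinearMap.mk₂_apply, Complex.mul_im, Complex.conj_re, Complex.conj_im,
        Complex.mul_re]
      nlinarith [mul_nonneg (sq_nonneg z.im) (sq_nonneg f.re),
        mul_nonneg (sq_nonneg z.im) (sq_nonneg f.im)]) n).zero_two
  rw [hz, map_zero] at key
  simp only [imForm, LinearMap.mk₂_apply, map_one, one_mul] at key
  have := mul_pos (S.gap_pos (Nat.zero_le n)) (mul_self_pos.2 h)
  linarith

/-- For `wronskianForm t` the lower bound is `S.gap 0`, since the Wronskian of `1` and `X` is `1`.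
At a zero of `endPoly 2` this gives simplicity and the sign of the residue of `Z`. -/
lemma wronskian_endPoly_pos (hg : ∀ k, 0 < S.g k) (t : ℝ) :
    0 < (S.endPoly 0).eval t * (derivative (S.endPoly 2)).eval t -
      (derivative (S.endPoly 0)).eval t * (S.endPoly 2).eval t := by
  have key := (S.interlaced_leftState hg (B := wronskianForm t) (x := X) (κ := t ^ 2)
    (fun f => by simp [wronskianForm]; ring) (sq_nonneg t)
    (fun f g => by simp [wronskianForm]; ring)
    (fun f => by
      simp only [wronskianForm, LinearMap.mk₂_apply, derivative_mul, derivative_X, eval_add,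
        eval_mul, eval_X, eval_one]
      nlinarith [sq_nonneg (f.eval t)]) n).zero_two
  refine lt_of_lt_of_le (S.gap_pos (Nat.zero_le n)) ?_
  simpa [wronskianForm, endPoly] using key

lemma leftState_pos (hg : ∀ k, 0 < S.g k) {t : ℝ} (ht : 0 < t) (k : ℕ) :
    0 < S.leftState t k 0 ∧ 0 ≤ S.leftState t k 1 ∧ 0 < S.leftState t k 2 := by
  induction k with
  | zero => simp [leftState_zero, mul_pos (S.gap_pos (Nat.zero_le n)) ht]
  | succ k ih =>
    obtain ⟨h0, h1, h2⟩ := ih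
    have hm := S.mass_nonneg hg k
    have hl := S.gap_nonneg (k + 1)
    simp only [leftState_succ, drift_zero, drift_one, drift_two, massJump_zero, massJump_one,
      massJump_two, smul_eq_mul]
    refine ⟨by positivity, by positivity, by positivity⟩

/-- At `lam = 0` the solution stays `(1, 0, 0)`, so to first order the third component grows with
the length travelled. The total length `2` is the source of the term `1 / (2 * lam)` in `Z`. -/
lemma leftState_poly_at_zero (k : ℕ) :
    (S.leftState (X : ℝ[X]) k 0).eval 0 = 1 ∧ (S.leftState (X : ℝ[X]) k 1).eval 0 = 0 ∧
    (S.leftState (X : ℝ[X]) k 2).eval 0 = 0 ∧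
    (derivative (S.leftState (X : ℝ[X]) k 2)).eval 0 = S.node (k + 1) + 1 := by
  induction k with
  | zero => simp [leftState_zero, gap, node_zero]
  | succ k ih =>
    obtain ⟨h0, h1, h2, h3⟩ := ih
    simp [leftState_succ, h0, h1, h2, h3, gap]
    ring

lemma eval_zero_endPoly_zero : (S.endPoly 0).eval 0 = 1 := (S.leftState_poly_at_zero n).1
lemma eval_zero_endPoly_one : (S.endPoly 1).eval 0 = 0 := (S.leftState_poly_at_zero n).2.1
lemma eval_zero_endPoly_two : (S.endPoly 2).eval 0 = 0 := (S.leftState_poly_at_zero n).2.2.1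
lemma eval_zero_derivative_endPoly_two : (derivative (S.endPoly 2)).eval 0 = 2 := by
  rw [endPoly, (S.leftState_poly_at_zero n).2.2.2, S.node_last]
  norm_num

/-- A mass passes the leading term of `v 2` to `v 0` with factor `g ^ 2 / 2`, and the next drift
returns it multiplied by `l * X`. Positive masses and gaps keep the leading coefficient positive. -/
lemma leftState_degree (hg : ∀ k, 0 < S.g k) {k : ℕ} (hk : k ≤ n) :
    (S.leftState (X : ℝ[X]) k 0).natDegree ≤ k ∧ (S.leftState (X : ℝ[X]) k 1).natDegree ≤ k ∧
    (S.leftState (X : ℝ[X]) k 2).natDegree ≤ k + 1 ∧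
    0 < (S.leftState (X : ℝ[X]) k 2).coeff (k + 1) := by
  have hadd : ∀ {p q : ℝ[X]} {m : ℕ}, p.natDegree ≤ m → q.natDegree ≤ m →
      (p + q).natDegree ≤ m := natDegree_add_le_of_degree_le
  have hsmul : ∀ (a : ℝ) {p : ℝ[X]} {m : ℕ}, p.natDegree ≤ m → (a • p).natDegree ≤ m :=
    fun a p m h => (natDegree_smul_le a p).trans h
  induction k with
  | zero =>
    refine ⟨by simp [leftState_zero], by simp [leftState_zero], ?_, ?_⟩
    · simpa [leftState_zero] using hsmul (S.gap 0) natDegree_X_le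
    · simpa [leftState_zero] using S.gap_pos hk
  | succ k ih =>
    obtain ⟨h0, h1, h2, h3⟩ := ih (by omega)
    have hm := S.mass_pos hg (show k < n by omega)
    have hl := S.gap_pos hk
    have h0' : (S.leftState (X : ℝ[X]) (k + 1) 0).natDegree ≤ k + 1 := by
      simp only [leftState_succ, drift_zero, massJump_zero]
      exact hadd (hadd (h0.trans k.le_succ) (hsmul _ (h1.trans k.le_succ))) (hsmul _ h2)
    have h0c : 0 < (S.leftState (X : ℝ[X]) (k + 1) 0).coeff (k + 1) := by
      simp only [leftState_succ, drift_zero, massJump_zero, coeff_add, coeff_smul, smul_eq_mul,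
        coeff_eq_zero_of_natDegree_lt (h0.trans_lt k.lt_succ_self),
        coeff_eq_zero_of_natDegree_lt (h1.trans_lt k.lt_succ_self)]
      have : 0 < S.mass k ^ 2 / 2 := by positivity
      simpa using mul_pos this h3
    have h22 : S.leftState (X : ℝ[X]) (k + 1) 2 =
        S.leftState X k 2 + S.gap (k + 1) • (X * S.leftState X (k + 1) 0) := rfl
    refine ⟨h0', ?_, ?_, ?_⟩
    · simp only [leftState_succ, drift_one, massJump_one]
      exact hadd (h1.trans k.le_succ) (hsmul _ h2)
    · rw [h22]
      refine hadd (h2.trans (Nat.le_succ _)) (hsmul _ ?_)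
      refine natDegree_mul_le.trans ?_
      rw [natDegree_X]
      omega
    · rw [h22, coeff_add, coeff_smul, coeff_X_mul,
        coeff_eq_zero_of_natDegree_lt (h2.trans_lt (Nat.lt_succ_self _)), zero_add]
      exact mul_pos hl h0c

lemma natDegree_endPoly_two (hg : ∀ k, 0 < S.g k) : (S.endPoly 2).natDegree = n + 1 :=
  have h := S.leftState_degree hg le_rfl
  le_antisymm h.2.2.1 (le_natDegree_of_ne_zero h.2.2.2.ne')

lemma natDegree_endPoly_zero_le (hg : ∀ k, 0 < S.g k) : (S.endPoly 0).natDegree ≤ n :=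
  (S.leftState_degree hg le_rfl).1

lemma natDegree_endPoly_one_le (hg : ∀ k, 0 < S.g k) : (S.endPoly 1).natDegree ≤ n :=
  (S.leftState_degree hg le_rfl).2.1

/-- The end value of the third component vanishes exactly at `n + 1` points
`-lam ≤ 0`. -/
lemma exists_zeros (hg : ∀ k, 0 < S.g k) :
    ∃ ev : Fin (n + 1) → ℝ, ev 0 = 0 ∧ StrictMono ev ∧
      ∀ lam : ℂ, S.leftState (-lam) n 2 = 0 ↔ lam ∈ range fun j => (ev j : ℂ) := by
  classical
  set q : ℂ[X] := (S.endPoly 2).map (algebraMap ℝ ℂ) with hq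
  have hdeg : q.natDegree = n + 1 := by
    rw [hq, natDegree_map, S.natDegree_endPoly_two hg]
  have hq0 : q ≠ 0 := by
    rintro h
    simp [h] at hdeg
  have hroot : ∀ z, z ∈ q.roots ↔ S.leftState z n 2 = 0 := fun z => by
    rw [mem_roots hq0, IsRoot.def, hq, eval_map_algebraMap, aeval_endPoly]
  have hreal : ∀ z ∈ q.roots, (z.re : ℂ) = z := fun z hz => by
    have := S.im_eq_zero_of_leftState_eq_zero hg ((hroot z).1 hz)
    exact Complex.ext rfl this.symm
  have hrootR : ∀ t : ℝ, (t : ℂ) ∈ q.roots ↔ (S.endPoly 2).eval t = 0 := fun t => by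
    rw [mem_roots hq0, IsRoot.def, hq, eval_map_algebraMap]
    change aeval (algebraMap ℝ ℂ t) _ = 0 ↔ _
    rw [aeval_algebraMap_apply, coe_aeval_eq_eval]
    exact map_eq_zero (algebraMap ℝ ℂ)
  -- A multiple root would be real and would make the Wronskian vanish there.
  have hnodup : q.roots.Nodup := by
    rw [Multiset.nodup_iff_count_le_one]
    intro z
    by_contra! h
    have hz : z ∈ q.roots := Multiset.count_pos.1 (by omega)
    rw [count_roots, one_lt_rootMultiplicity_iff_isRoot hq0] at h
    have hd := h.2
    have hz' := hz
    rw [← hreal z hz] at hz' hd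
    rw [IsRoot.def, hq, derivative_map, eval_map_algebraMap] at hd
    change aeval (algebraMap ℝ ℂ z.re) _ = 0 at hd
    rw [aeval_algebraMap_apply, coe_aeval_eq_eval] at hd
    have hd' := (map_eq_zero (algebraMap ℝ ℂ)).1 hd
    have := S.wronskian_endPoly_pos hg z.re
    rw [hd', (hrootR _).1 hz'] at this
    simp at this
  -- The polynomial variable is `-lam`, so eigenvalues are the negated roots.
  set F : Finset ℝ := q.roots.toFinset.image fun z => -z.re with hF
  have hcard : F.card = n + 1 := by
    rw [hF, Finset.card_image_of_injOn, Multiset.toFinset_card_of_nodup hnodup,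
      IsAlgClosed.card_roots_eq_natDegree, hdeg]
    intro z hz w hw h
    rw [← hreal z (by simpa using hz), ← hreal w (by simpa using hw), neg_injective h]
  have hmem : ∀ t : ℝ, t ∈ F ↔ (S.endPoly 2).eval (-t) = 0 := fun t => by
    rw [← hrootR, hF, Finset.mem_image]
    constructor
    · rintro ⟨z, hz, rfl⟩
      rw [Multiset.mem_toFinset] at hz
      rwa [neg_neg, hreal z hz]
    · intro h
      exact ⟨((-t : ℝ) : ℂ), Multiset.mem_toFinset.2 h, by simp⟩
  have hnonneg : ∀ t ∈ F, 0 ≤ t := fun t ht => by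
    by_contra! h
    have := (S.leftState_pos hg (neg_pos.2 h) n).2.2
    rw [← eval_endPoly, (hmem t).1 ht] at this
    exact this.false
  have hzero : (0 : ℝ) ∈ F := by
    rw [hmem, neg_zero, eval_zero_endPoly_two]
  refine ⟨F.orderEmbOfFin hcard, ?_, (F.orderEmbOfFin hcard).strictMono, fun lam => ?_⟩
  · refine le_antisymm ?_ (hnonneg _ (F.orderEmbOfFin_mem hcard 0))
    obtain ⟨j, hj⟩ : (0 : ℝ) ∈ range (F.orderEmbOfFin hcard) := by
      simpa using hzero
    rw [← hj]
    exact (F.orderEmbOfFin hcard).monotone (Fin.zero_le j)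
  · rw [← hroot]
    constructor
    · intro h
      obtain ⟨j, hj⟩ : (lam.re : ℝ) ∈ range (F.orderEmbOfFin hcard) := by
        rw [Finset.range_orderEmbOfFin, Finset.mem_coe, hF, Finset.mem_image]
        exact ⟨-lam, Multiset.mem_toFinset.2 h, by simp⟩
      refine ⟨j, ?_⟩
      simp only [hj]
      simpa using hreal _ h
    · rintro ⟨j, rfl⟩
      have := (hrootR _).2 ((hmem _).1 (F.orderEmbOfFin_mem hcard j))
      simpa using this

end DualCubicString

/-! ### Solutions of the system versus products of transfer maps. -/

lemma eq_of_hasDerivAt_zero_of_tendsto {f : ℝ → ℂ} {a b : ℝ} {p : ℂ}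
    (hf : ∀ y ∈ Ioo a b, HasDerivAt f 0 y) (hp : Tendsto f (𝓝[>] a) (𝓝 p)) :
    ∀ y ∈ Ioo a b, f y = p := by
  intro y hy
  obtain ⟨c, hc⟩ := isOpen_Ioo.exists_is_const_of_deriv_eq_zero isPreconnected_Ioo
    (fun t ht => (hf t ht).differentiableAt.differentiableWithinAt) (fun t ht => (hf t ht).deriv)
  have hev : f =ᶠ[𝓝[>] a] fun _ => c :=
    eventually_of_mem (Ioo_mem_nhdsGT (hy.1.trans hy.2)) hc
  rw [hc y hy]
  exact tendsto_nhds_unique (tendsto_const_nhds.congr' hev.symm) hp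

lemma continuous_drift (x : ℂ) (a : ℝ) (v : Fin 3 → ℂ) :
    Continuous fun t : ℝ => drift x (t - a) v := by
  refine continuous_pi fun i => ?_
  fin_cases i <;> simp <;> fun_prop

namespace DualCubicString

variable {n : ℕ} (S : DualCubicString n)

lemma y_eq_node (k : Fin n) : S.y k = S.node (k + 1) := (S.node_succ k.2).symm

lemma g_eq_mass (k : Fin n) : S.g k = S.mass k := by simp [mass]

lemma notMem_range_of_mem_Ioo {k : ℕ} {y : ℝ} (hy : y ∈ Ioo (S.node k) (S.node (k + 1))) :
    y ∉ range S.y := by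
  rintro ⟨j, rfl⟩
  rw [y_eq_node] at hy
  rcases lt_or_ge (j : ℕ) k with h | h
  · exact absurd hy.1 (S.node_monotone h).not_gt
  · exact absurd hy.2 (S.node_monotone (Nat.succ_le_succ h)).not_gt

lemma Ioo_node_subset {k : ℕ} (hk : k ≤ n) :
    Ioo (S.node k) (S.node (k + 1)) ⊆ Ioo (-1) 1 :=
  Ioo_subset_Ioo (S.node_monotone (Nat.zero_le k))
    ((S.node_monotone (Nat.succ_le_succ hk)).trans_eq S.node_last)

lemma exists_mem_Ioo_node {y : ℝ} (hy : y ∈ Ioo (-1) 1) (hyS : y ∉ range S.y) :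
    ∃ k ≤ n, y ∈ Ioo (S.node k) (S.node (k + 1)) := by
  classical
  have hex : ∃ k, y < S.node k := ⟨n + 1, by rw [S.node_last]; exact hy.2⟩
  have hpos : Nat.find hex ≠ 0 := fun h => by
    have := Nat.find_spec hex
    rw [h, node_zero] at this
    exact this.not_gt hy.1
  obtain ⟨k, hk⟩ := Nat.exists_eq_succ_of_ne_zero hpos
  have hkn : k ≤ n := by
    have := Nat.find_min' hex (show y < S.node (n + 1) by rw [S.node_last]; exact hy.2)
    omega
  have hlt := Nat.find_spec hex
  rw [hk] at hlt
  refine ⟨k, hkn, lt_of_le_of_ne (not_lt.1 (Nat.find_min hex (m := k) (by omega))) ?_, hlt⟩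
  rintro rfl
  cases k with
  | zero => exact hy.1.ne rfl
  | succ k => exact hyS ⟨⟨k, by omega⟩, (S.node_succ (by omega)).symm⟩

lemma neg_one_notMem_range : (-1 : ℝ) ∉ range S.y := by
  rintro ⟨j, hj⟩
  exact (S.neg_one_lt_y j).ne hj.symm

variable {S} {lam : ℂ} {Φ Ψ : ℝ → Fin 3 → ℂ}

lemma IsSolution.eq_drift (h : S.IsSolution lam Φ) {k : ℕ} (hk : k ≤ n) {v : Fin 3 → ℂ}
    (hv : ∀ i, Tendsto (fun t => Φ t i) (𝓝[>] S.node k) (𝓝 (v i))) {y : ℝ}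
    (hy : y ∈ Ioo (S.node k) (S.node (k + 1))) :
    Φ y = drift (-lam) (y - S.node k) v := by
  have hmem : ∀ t ∈ Ioo (S.node k) (S.node (k + 1)), t ∈ Ioo (-1 : ℝ) 1 ∧ t ∉ range S.y :=
    fun t ht => ⟨S.Ioo_node_subset hk ht, S.notMem_range_of_mem_Ioo ht⟩
  have h0 := eq_of_hasDerivAt_zero_of_tendsto
    (fun t ht => h.hasDerivAt_one t (hmem t ht).1 (hmem t ht).2) (hv 0)
  have h1 := eq_of_hasDerivAt_zero_of_tendsto
    (fun t ht => h.hasDerivAt_two t (hmem t ht).1 (hmem t ht).2) (hv 1)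
  -- Adding this linear function cancels the constant slope of `φ₃`, leaving a function with zero
  -- derivative.
  have hlin : ∀ t : ℝ, HasDerivAt (fun s : ℝ => ((s - S.node k : ℝ) : ℂ) * (lam * v 0))
      (lam * v 0) t := fun t => by
    simpa using (((hasDerivAt_id t).sub_const (S.node k)).ofReal_comp).mul_const (lam * v 0)
  have h2 := eq_of_hasDerivAt_zero_of_tendsto (a := S.node k) (b := S.node (k + 1)) (p := v 2)
    (f := fun t => Φ t 2 + ((t - S.node k : ℝ) : ℂ) * (lam * v 0))
    (fun t ht => by
      have := (h.hasDerivAt_three t (hmem t ht).1 (hmem t ht).2).add (hlin t)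
      rw [h0 t ht] at this
      exact this.congr_deriv (by ring))
    (by
      have := (hv 2).add ((hlin (S.node k)).continuousAt.tendsto.mono_left
        (nhdsWithin_le_nhds (s := Ioi (S.node k))))
      simpa using this)
  funext i
  fin_cases i
  · exact h0 y hy
  · exact h1 y hy
  · have := h2 y hy
    simp only [Fin.reduceFinMk, drift_two, Complex.real_smul]
    linear_combination this

lemma IsSolution.tendsto_drift (h : S.IsSolution lam Φ) {k : ℕ} (hk : k ≤ n) {v : Fin 3 → ℂ}
    (hv : ∀ i, Tendsto (fun t => Φ t i) (𝓝[>] S.node k) (𝓝 (v i))) :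
    Tendsto Φ (𝓝[<] S.node (k + 1)) (𝓝 (drift (-lam) (S.gap k) v)) := by
  refine (((continuous_drift (-lam) (S.node k) v).tendsto (S.node (k + 1))).mono_left
    nhdsWithin_le_nhds).congr' ?_
  exact eventually_of_mem (Ioo_mem_nhdsLT (S.node_lt_succ hk)) fun y hy => (h.eq_drift hk hv hy).symm

lemma IsSolution.tendsto_state (h : S.IsSolution lam Φ) {k : ℕ} (hk : k ≤ n) (i : Fin 3) :
    Tendsto (fun t => Φ t i) (𝓝[>] S.node k) (𝓝 (S.state (-lam) (Φ (-1)) k i)) := by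
  induction k generalizing i with
  | zero =>
    have := h.continuous_left.tendsto.mono_left (nhdsWithin_mono _ Ioi_subset_Ici_self)
    exact tendsto_pi_nhds.1 this i
  | succ k ih =>
    have hleft := tendsto_pi_nhds.1 (h.tendsto_drift (by omega) (ih (by omega)))
    obtain ⟨p₁, q₁, p₂, q₂, hp₁, hq₁, hp₂, hq₂, hj₁, hj₂⟩ := h.jump ⟨k, hk⟩
    have hc := h.continuousAt_three ⟨k, hk⟩
    rw [g_eq_mass] at hj₁ hj₂
    rw [y_eq_node] at hp₁ hq₁ hp₂ hq₂ hj₂ hc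
    have e₁ := tendsto_nhds_unique hp₁ (hleft 0)
    have e₂ := tendsto_nhds_unique hp₂ (hleft 1)
    have e₃ := tendsto_nhds_unique (hc.tendsto.mono_left nhdsWithin_le_nhds) (hleft 2)
    -- Substituting the jump of `φ₂` into the averaged jump of `φ₁` produces the `g ^ 2 / 2` entry.
    have s₀ : S.state (-lam) (Φ (-1)) (k + 1) 0 = q₁ := by
      simp only [state, massJump_zero, ← e₁, ← e₂, ← e₃, Complex.real_smul]
      push_cast
      linear_combination -hj₁ - (S.mass k : ℂ) / 2 * hj₂
    have s₁ : S.state (-lam) (Φ (-1)) (k + 1) 1 = q₂ := by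
      simp only [state, massJump_one, ← e₂, ← e₃, Complex.real_smul]
      linear_combination -hj₂
    have s₂ : S.state (-lam) (Φ (-1)) (k + 1) 2 = Φ (S.node (k + 1)) 2 := by
      simp only [state, massJump_two, ← e₃]
    rw [← s₀] at hq₁
    rw [← s₁] at hq₂
    have hq₃ := hc.tendsto.mono_left (nhdsWithin_le_nhds (s := Ioi (S.node (k + 1))))
    rw [← s₂] at hq₃
    fin_cases i
    exacts [hq₁, hq₂, hq₃]

lemma IsSolution.apply_one (h : S.IsSolution lam Φ) :
    Φ 1 = drift (-lam) (S.gap n) (S.state (-lam) (Φ (-1)) n) := by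
  have h1 := h.tendsto_drift le_rfl (h.tendsto_state le_rfl)
  rw [S.node_last] at h1
  exact tendsto_nhds_unique
    (h.continuous_right.tendsto.mono_left (nhdsWithin_mono _ Iio_subset_Iic_self)) h1

/-- Off the masses a solution is a linear function of its value at `-1`. The scalar `a` lets one
statement yield both uniqueness (`a = 1`) and one-dimensional eigenspaces. -/
lemma IsSolution.eq_smul (h : S.IsSolution lam Φ) (h' : S.IsSolution lam Ψ) {a : ℂ}
    (ha : Φ (-1) = a • Ψ (-1)) {y : ℝ} (hy : y ∈ Icc (-1) 1) (hyS : y ∉ range S.y) :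
    Φ y = a • Ψ y := by
  rcases hy.1.eq_or_lt with rfl | h1
  · exact ha
  rcases hy.2.eq_or_lt with rfl | h2
  · rw [h.apply_one, h'.apply_one, ha, state_smul, drift_smul]
  obtain ⟨k, hk, hyk⟩ := S.exists_mem_Ioo_node ⟨h1, h2⟩ hyS
  rw [h.eq_drift hk (h.tendsto_state hk) hyk, h'.eq_drift hk (h'.tendsto_state hk) hyk, ha,
    state_smul, drift_smul]

variable (S)

/-- The number of the interval between nodes that contains `y`. -/
noncomputable def interval (y : ℝ) : ℕ := sInf {k | y ≤ S.node (k + 1)}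

/-- Intervals are closed on the right, so the explicit solution takes its left limits at the masses.
The alternative `k = 0` admits the left endpoint `-1`. -/
lemma interval_eq {k : ℕ} {y : ℝ} (hy : y ≤ S.node (k + 1)) (hk : k = 0 ∨ S.node k < y) :
    S.interval y = k := by
  refine le_antisymm (Nat.sInf_le hy) ?_
  by_contra! hlt
  have hmem : S.interval y ∈ {k | y ≤ S.node (k + 1)} := Nat.sInf_mem ⟨k, hy⟩
  rcases hk with rfl | hk
  · omega
  · exact absurd hk (hmem.trans (S.node_monotone hlt)).not_gt

/-- The normalized solution, in closed form. -/
noncomputable def explicitSolution (lam : ℂ) (y : ℝ) : Fin 3 → ℂ :=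
  drift (-lam) (y - S.node (S.interval y)) (S.state (-lam) ![1, 0, 0] (S.interval y))

lemma explicitSolution_eq (lam : ℂ) {k : ℕ} {y : ℝ} (hy : y ≤ S.node (k + 1))
    (hk : k = 0 ∨ S.node k < y) :
    S.explicitSolution lam y = drift (-lam) (y - S.node k) (S.state (-lam) ![1, 0, 0] k) := by
  rw [explicitSolution, S.interval_eq hy hk]

lemma explicitSolution_isNormalized (lam : ℂ) :
    S.IsNormalizedSolution lam (S.explicitSolution lam) := by
  set s := S.state (-lam) ![1, 0, 0] with hs
  have hloc : ∀ y ∈ Ioo (-1 : ℝ) 1, y ∉ range S.y → ∃ k,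
      S.explicitSolution lam =ᶠ[𝓝 y] fun t => drift (-lam) (t - S.node k) (s k) :=
    fun y hy hyS => by
      obtain ⟨k, -, hyk⟩ := S.exists_mem_Ioo_node hy hyS
      exact ⟨k, eventually_of_mem (isOpen_Ioo.mem_nhds hyk) fun t ht =>
        S.explicitSolution_eq lam ht.2.le (Or.inr ht.1)⟩
  have hle : ∀ k ≤ n, Tendsto (S.explicitSolution lam) (𝓝[≤] S.node (k + 1))
      (𝓝 (drift (-lam) (S.gap k) (s k))) := fun k hk => by
    refine (((continuous_drift (-lam) (S.node k) (s k)).tendsto (S.node (k + 1))).mono_left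
      nhdsWithin_le_nhds).congr' ?_
    exact eventually_of_mem (Ioc_mem_nhdsLE (S.node_lt_succ hk)) fun t ht =>
      (S.explicitSolution_eq lam ht.2 (Or.inr ht.1)).symm
  have hgt : ∀ k ≤ n, Tendsto (S.explicitSolution lam) (𝓝[>] S.node k) (𝓝 (s k)) :=
    fun k hk => by
      have h := ((continuous_drift (-lam) (S.node k) (s k)).tendsto (S.node k)).mono_left
        (nhdsWithin_le_nhds (s := Ioi (S.node k)))
      have hs0 : drift (-lam) (S.node k - S.node k) (s k) = s k := by
        funext i
        fin_cases i <;> simp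
      rw [hs0] at h
      refine h.congr' ?_
      exact eventually_of_mem (Ioo_mem_nhdsGT (S.node_lt_succ hk)) fun t ht =>
        (S.explicitSolution_eq lam ht.2.le (Or.inr ht.1)).symm
  have hval : ∀ k ≤ n, S.explicitSolution lam (S.node (k + 1)) =
      drift (-lam) (S.gap k) (s k) := fun k hk =>
    S.explicitSolution_eq lam le_rfl (Or.inr (S.node_lt_succ hk))
  have hinit : S.explicitSolution lam (-1) = ![1, 0, 0] := by
    have h1 : (-1 : ℝ) ≤ S.node (0 + 1) := S.node_monotone (Nat.zero_le 1)
    rw [S.explicitSolution_eq lam h1 (Or.inl rfl)]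
    funext i
    fin_cases i <;> simp [state, node_zero]
  refine ⟨⟨fun y hy hyS => ?_, fun y hy hyS => ?_, fun y hy hyS => ?_, fun k => ?_, fun k => ?_,
    ?_, ?_⟩, hinit⟩
  · obtain ⟨k, hk⟩ := hloc y hy hyS
    exact (hasDerivAt_const y (s k 0)).congr_of_eventuallyEq (hk.mono fun t ht => congrFun ht 0)
  · obtain ⟨k, hk⟩ := hloc y hy hyS
    exact (hasDerivAt_const y (s k 1)).congr_of_eventuallyEq (hk.mono fun t ht => congrFun ht 1)
  · obtain ⟨k, hk⟩ := hloc y hy hyS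
    refine HasDerivAt.congr_of_eventuallyEq ?_ (hk.mono fun t ht => congrFun ht 2)
    rw [hk.self_of_nhds]
    have := ((((hasDerivAt_id y).sub_const (S.node k)).ofReal_comp).mul_const
      (-lam * s k 0)).const_add (s k 2)
    simpa using this
  · rw [y_eq_node, continuousAt_iff_continuous_left'_right', ContinuousWithinAt,
      ContinuousWithinAt, hval k k.2.le]
    refine ⟨(tendsto_pi_nhds.1 (hle k k.2.le) 2).mono_left
      (nhdsWithin_mono _ Iio_subset_Iic_self), ?_⟩
    exact tendsto_pi_nhds.1 (hgt (k + 1) k.2) 2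
  · have hl := tendsto_pi_nhds.1
      ((hle k k.2.le).mono_left (nhdsWithin_mono _ Iio_subset_Iic_self))
    have hr := tendsto_pi_nhds.1 (hgt (k + 1) k.2)
    rw [y_eq_node, g_eq_mass, hval k k.2.le]
    refine ⟨_, _, _, _, hl 0, hr 0, hl 1, hr 1, ?_, ?_⟩
    · simp only [hs, state, massJump_zero, massJump_one, Complex.real_smul]
      push_cast
      ring
    · simp only [hs, state, massJump_one, Complex.real_smul]
      ring
  · rw [← continuousWithinAt_Ioi_iff_Ici, ContinuousWithinAt, hinit]
    exact hgt 0 (Nat.zero_le n)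
  · have := hle n le_rfl
    rw [← hval n le_rfl, S.node_last] at this
    exact this

lemma phi_isNormalized (lam : ℂ) : S.IsNormalizedSolution lam (S.phi lam) :=
  Classical.epsilon_spec ⟨_, S.explicitSolution_isNormalized lam⟩

lemma phi_one (lam : ℂ) : S.phi lam 1 = S.leftState (-lam) n := by
  rw [(S.phi_isNormalized lam).1.apply_one, (S.phi_isNormalized lam).2, leftState]

lemma IsNormalizedSolution.eq_phi {S : DualCubicString n} (h : S.IsNormalizedSolution lam Φ)
    {y : ℝ} (hy : y ∈ Icc (-1) 1) (hyS : y ∉ range S.y) : Φ y = S.phi lam y := by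
  simpa using h.1.eq_smul (S.phi_isNormalized lam).1 (a := 1)
    (by rw [h.2, (S.phi_isNormalized lam).2, one_smul]) hy hyS

lemma IsEigenfunction.eq_smul_phi {S : DualCubicString n} (h : S.IsEigenfunction lam Φ) {y : ℝ}
    (hy : y ∈ Icc (-1) 1) (hyS : y ∉ range S.y) : Φ y = Φ (-1) 0 • S.phi lam y := by
  refine h.1.eq_smul (S.phi_isNormalized lam).1 ?_ hy hyS
  rw [(S.phi_isNormalized lam).2]
  funext i
  fin_cases i
  · simp
  · simpa using h.2.1
  · simpa using h.2.2.1

/-- An eigenfunction is a multiple of `S.phi lam` off the masses, with a nonzero factor by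
nontriviality; the only condition left is `φ₃(1) = 0`. -/
lemma mem_spectrum_iff : lam ∈ S.spectrum ↔ S.leftState (-lam) n 2 = 0 := by
  constructor
  · rintro ⟨Φ, hΦ⟩
    have h1 : (1 : ℝ) ∉ range S.y := by
      rintro ⟨j, hj⟩
      exact (S.y_lt_one j).ne hj
    have hend := congrFun (hΦ.eq_smul_phi (y := 1) (by simp) h1) 2
    rw [hΦ.2.2.2.1, S.phi_one, Pi.smul_apply, smul_eq_mul] at hend
    refine (mul_eq_zero.1 hend.symm).resolve_left fun h0 => ?_
    obtain ⟨y, hy, hyS, hne⟩ := hΦ.2.2.2.2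
    exact hne (by rw [hΦ.eq_smul_phi hy hyS, h0, zero_smul])
  · intro h
    obtain ⟨hsol, hinit⟩ := S.phi_isNormalized lam
    refine ⟨S.phi lam, hsol, by simp [hinit], by simp [hinit], by rw [S.phi_one, h], -1,
      by simp, S.neg_one_notMem_range, fun h0 => ?_⟩
    rw [hinit] at h0
    simpa using congrFun h0 0

end DualCubicString

/-! ### Partial fractions and odd rational functions. -/

open Polynomial in
-- `Q` is a constant times the nodal polynomial of its roots, so Lagrange interpolation of `P` at
-- these roots, divided by `Q`, is the partial fraction expansion.
lemma eval_div_eq_sum_div {ι : Type*} [Fintype ι] {P Q : ℂ[X]} {z : ι → ℂ}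
    (hz : Function.Injective z) (hQ : Q.natDegree = Fintype.card ι) (hQ0 : Q ≠ 0)
    (hroot : ∀ i, Q.eval (z i) = 0) (hP : P.degree < Fintype.card ι) {x : ℂ}
    (hx : Q.eval x ≠ 0) :
    P.eval x / Q.eval x = ∑ i, P.eval (z i) / (derivative Q).eval (z i) / (x - z i) := by
  classical
  have ha : Q.leadingCoeff ≠ 0 := leadingCoeff_ne_zero.2 hQ0
  have hQn : Q = C Q.leadingCoeff * Lagrange.nodal Finset.univ z := by
    have hd : Q.degree = (C Q.leadingCoeff * Lagrange.nodal Finset.univ z).degree := by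
      rw [degree_C_mul ha, Lagrange.degree_nodal, degree_eq_natDegree hQ0, hQ, Finset.card_univ]
    refine Polynomial.eq_of_degree_sub_lt_of_eval_index_eq (v := z) Finset.univ hz.injOn ?_ ?_
    · rw [Finset.card_univ, ← hQ, ← degree_eq_natDegree hQ0]
      exact degree_sub_lt_left hd hQ0
        (by simp [(Lagrange.nodal_monic (s := Finset.univ) (v := z)).leadingCoeff])
    · intro i _
      simp [hroot, Lagrange.eval_nodal_at_node (Finset.mem_univ i)]
  have hxz : ∀ i, x ≠ z i := fun i h => hx (h ▸ hroot i)
  have hnod : (Lagrange.nodal Finset.univ z).eval x ≠ 0 := fun h => hx (by rw [hQn]; simp [h])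
  have hPe := Lagrange.eq_interpolate (s := Finset.univ) (v := z) (f := P) hz.injOn
    (by rwa [Finset.card_univ])
  have hPx : P.eval x = (Lagrange.nodal Finset.univ z).eval x * ∑ i,
      Lagrange.nodalWeight Finset.univ z i * (x - z i)⁻¹ * P.eval (z i) := by
    conv_lhs => rw [hPe]
    exact Lagrange.eval_interpolate_not_at_node _ fun i _ => hxz i
  have hQx : Q.eval x = Q.leadingCoeff * (Lagrange.nodal Finset.univ z).eval x := by
    conv_lhs => rw [hQn]
    simp
  have hQ' : ∀ i, (derivative Q).eval (z i) =
      Q.leadingCoeff * (derivative (Lagrange.nodal Finset.univ z)).eval (z i) := fun i => by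
    conv_lhs => rw [hQn]
    simp
  rw [hPx, hQx, mul_comm Q.leadingCoeff, mul_div_mul_left _ _ hnod, Finset.sum_div]
  refine Finset.sum_congr rfl fun i _ => ?_
  rw [hQ', Lagrange.nodalWeight_eq_eval_derivative_nodal (Finset.mem_univ i)]
  simp only [div_eq_mul_inv, mul_inv]
  ring

open Polynomial in
/-- An odd rational function that vanishes at infinity and has only positive, simple poles
is zero. -/
lemma sum_div_eq_zero_of_odd {ι : Type*} [Fintype ι] {a : ι → ℝ} (ha : ∀ i, 0 < a i)
    {d : ι → ℂ} {F : Set ℂ} (hF : F.Finite)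
    (hodd : ∀ lam ∉ F, ∑ i, d i / (lam - a i) + ∑ i, d i / (-lam - a i) = 0) {lam : ℂ}
    (hlam : ∀ i, lam ≠ a i) : ∑ i, d i / (lam - a i) = 0 := by
  classical
  set Q : ℂ[X] := ∏ i, (X - C (a i : ℂ)) with hQ
  set N : ℂ[X] := ∑ i, C (d i) * ∏ j ∈ Finset.univ.erase i, (X - C (a j : ℂ)) with hN
  have hQx : ∀ x : ℂ, (∀ i, x ≠ a i) → Q.eval x ≠ 0 := fun x hx => by
    rw [hQ, eval_prod, Finset.prod_ne_zero_iff]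
    intro i _
    simpa using sub_ne_zero.2 (hx i)
  have hNx : ∀ x : ℂ, (∀ i, x ≠ a i) → N.eval x = Q.eval x * ∑ i, d i / (x - a i) :=
    fun x hx => by
      rw [hN, hQ, eval_finsetSum, Finset.mul_sum]
      refine Finset.sum_congr rfl fun i _ => ?_
      have := sub_ne_zero.2 (hx i)
      rw [← Finset.mul_prod_erase Finset.univ _ (Finset.mem_univ i)]
      simp only [eval_mul, eval_C, eval_sub, eval_X]
      field_simp
  -- Clearing denominators turns oddness off a finite set into a polynomial identity.
  have hid : N * Q.comp (-X) + N.comp (-X) * Q = 0 := by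
    refine eq_zero_of_infinite_isRoot _ (Infinite.mono ?_
      ((hF.union ((finite_range fun i => (a i : ℂ)).union
        (finite_range fun i => -(a i : ℂ)))).infinite_compl))
    intro x hx
    simp only [mem_compl_iff, mem_union, mem_range, not_or, not_exists] at hx
    obtain ⟨hxF, hx1, hx2⟩ := hx
    have h1 : ∀ i, x ≠ a i := fun i h => hx1 i h.symm
    have h2 : ∀ i, -x ≠ a i := fun i h => hx2 i (by rw [← h, neg_neg])
    simp only [mem_ofPred_eq, IsRoot.def, eval_add, eval_mul, eval_comp, eval_neg, eval_X,
      hNx x h1, hNx (-x) h2]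
    linear_combination Q.eval x * Q.eval (-x) * hodd x hxF
  -- The roots of `Q` are positive and those of `Q.comp (-X)` negative. The `a i` may repeat, as
  -- when two strings share eigenvalues.
  have hcop : IsCoprime Q (Q.comp (-X)) := by
    rw [hQ, prod_comp]
    refine IsCoprime.prod_left fun i _ => IsCoprime.prod_right fun j _ => ?_
    have hne : (a i : ℂ) + a j ≠ 0 := by exact_mod_cast (add_pos (ha i) (ha j)).ne'
    refine ⟨-C ((a i + a j : ℂ)⁻¹), -C ((a i + a j : ℂ)⁻¹), ?_⟩
    have : C ((a i + a j : ℂ)⁻¹) * (C (a i : ℂ) + C (a j : ℂ)) = 1 := by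
      rw [← C_add, ← C_mul, inv_mul_cancel₀ hne, C_1]
    simp only [sub_comp, X_comp, C_comp]
    linear_combination this
  have hdvd : Q ∣ N :=
    hcop.dvd_of_dvd_mul_right ⟨-N.comp (-X), by linear_combination hid⟩
  have hNdeg : N.degree < Q.degree := by
    have hQd : Q.degree = Fintype.card ι := by
      rw [hQ, degree_prod]
      simp
    rw [hQd, hN]
    refine (degree_sum_le _ _).trans_lt ((Finset.sup_lt_iff (WithBot.bot_lt_coe _)).2 ?_)
    intro i _
    refine ((degree_mul_le _ _).trans (add_le_of_nonpos_left degree_C_le)).trans_lt ?_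
    rw [degree_prod]
    simp only [degree_X_sub_C, Finset.sum_const, nsmul_eq_mul, mul_one,
      Finset.card_erase_of_mem (Finset.mem_univ i), Finset.card_univ]
    exact_mod_cast Nat.sub_lt (Fintype.card_pos_iff.2 ⟨i⟩) one_pos
  have hN0 : N = 0 := eq_zero_of_dvd_of_degree_lt hdvd hNdeg
  have := hNx lam hlam
  rw [hN0, eval_zero] at this
  exact (mul_eq_zero.1 this.symm).resolve_left (hQx lam hlam)

/-! ### Weyl functions, residues and the dependence of `Z` on `W`. -/

namespace DualCubicString

open Polynomial

variable {n : ℕ} (S : DualCubicString n)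

lemma weylW_eq (lam : ℂ) :
    S.weylW lam = -(S.leftState (-lam) n 1 / S.leftState (-lam) n 2) := by
  rw [weylW, phi_one]

lemma weylZ_eq (lam : ℂ) :
    S.weylZ lam = -(S.leftState (-lam) n 0 / S.leftState (-lam) n 2) := by
  rw [weylZ, phi_one]

lemma weylZ_add_weylZ_neg {lam : ℂ} (h : lam ∉ S.spectrum) (h' : -lam ∉ S.spectrum) :
    S.weylZ lam + S.weylZ (-lam) + S.weylW lam * S.weylW (-lam) = 0 := by
  rw [mem_spectrum_iff] at h h'
  rw [neg_neg] at h'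
  simp only [weylW_eq, weylZ_eq, neg_neg]
  field_simp
  have := S.leftState_neg lam n
  linear_combination -this

lemma leftState_ofReal (t : ℝ) (i : Fin 3) :
    S.leftState (t : ℂ) n i = (((S.endPoly i).eval t : ℝ) : ℂ) := by
  rw [← aeval_endPoly]
  change aeval (algebraMap ℝ ℂ t) _ = _
  rw [aeval_algebraMap_apply, coe_aeval_eq_eval]
  rfl

/-- The residue, at the point `lam = e`, of the quotient `-φᵢ(1; lam) / φ₃(1; lam)`. -/
noncomputable def residue (i : Fin 3) (e : ℝ) : ℝ :=
  (S.endPoly i).eval (-e) / (derivative (S.endPoly 2)).eval (-e)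

/-- In the variable `-lam` the roots are `-ev j`; the outer minus sign turns `1 / (-lam + ev j)`
into `1 / (lam - ev j)`. -/
lemma neg_div_eq_sum_residue (hg : ∀ k, 0 < S.g k) {ev : Fin (n + 1) → ℝ}
    (hev : Function.Injective ev)
    (hsp : ∀ lam : ℂ, S.leftState (-lam) n 2 = 0 ↔ lam ∈ range fun j => (ev j : ℂ))
    {i : Fin 3} (hi : (S.endPoly i).natDegree ≤ n) {lam : ℂ} (hlam : lam ∉ S.spectrum) :
    -(S.leftState (-lam) n i / S.leftState (-lam) n 2) =
      ∑ j, (S.residue i (ev j) : ℂ) / (lam - ev j) := by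
  have hval : ∀ (i : Fin 3) (z : ℂ),
      ((S.endPoly i).map (algebraMap ℝ ℂ)).eval z = S.leftState z n i := fun i z => by
    rw [eval_map_algebraMap, aeval_endPoly]
  have hdeg : ((S.endPoly 2).map (algebraMap ℝ ℂ)).natDegree = n + 1 := by
    rw [natDegree_map, S.natDegree_endPoly_two hg]
  have key := eval_div_eq_sum_div (P := (S.endPoly i).map (algebraMap ℝ ℂ))
    (Q := (S.endPoly 2).map (algebraMap ℝ ℂ)) (z := fun j => ((-ev j : ℝ) : ℂ)) (x := -lam)
    (fun j k h => hev (neg_injective (Complex.ofReal_injective h))) (by simpa using hdeg)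
    (by rintro h; simp [h] at hdeg)
    (fun j => by
      rw [hval, Complex.ofReal_neg]
      exact (hsp _).2 ⟨j, rfl⟩)
    (by
      refine degree_le_natDegree.trans_lt ?_
      rw [natDegree_map, Fintype.card_fin]
      exact_mod_cast Nat.lt_succ_of_le hi)
    (by rw [hval]; rwa [mem_spectrum_iff] at hlam)
  rw [hval, hval] at key
  rw [key, ← Finset.sum_neg_distrib]
  refine Finset.sum_congr rfl fun j _ => ?_
  have hd : (derivative ((S.endPoly 2).map (algebraMap ℝ ℂ))).eval ((-ev j : ℝ) : ℂ) =
      (((derivative (S.endPoly 2)).eval (-ev j) : ℝ) : ℂ) := by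
    rw [derivative_map, eval_map_algebraMap]
    change aeval (algebraMap ℝ ℂ (-ev j)) _ = _
    rw [aeval_algebraMap_apply, coe_aeval_eq_eval]
    rfl
  rw [hval, leftState_ofReal, hd, residue, Complex.ofReal_div, ← div_neg]
  congr 1
  push_cast
  ring

lemma hasDerivAt_phi (lam : ℂ) : HasDerivAt (fun lam => S.phi lam 1 2)
    (-aeval (-lam) (derivative (S.endPoly 2))) lam := by
  have h : (fun lam : ℂ => S.phi lam 1 2) = fun lam => aeval (-lam) (S.endPoly 2) := by
    funext lam
    rw [phi_one, aeval_endPoly]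
  rw [h]
  have := ((S.endPoly 2).hasDerivAt_aeval (-lam)).comp lam (hasDerivAt_neg lam)
  rwa [mul_neg_one] at this

lemma exists_spectral_data (hg : ∀ k, 0 < S.g k) :
    ∃ (ev : Fin (n + 1) → ℝ) (b c : Fin n → ℝ),
      ev 0 = 0 ∧ StrictMono ev ∧
      S.spectrum = Set.range (fun j => (ev j : ℂ)) ∧
      (∀ j, S.phi (ev j) 1 2 = 0 ∧ deriv (fun lam => S.phi lam 1 2) (ev j : ℂ) ≠ 0) ∧
      (∀ k, 0 < b k) ∧ (∀ k, 0 < c k) ∧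
      (∀ lam ∉ S.spectrum, S.weylW lam = ∑ k, (b k : ℂ) / (lam - ev k.succ)) ∧
      (∀ lam ∉ S.spectrum,
        S.weylZ lam = 1 / (2 * lam) + ∑ k, (c k : ℂ) / (lam - ev k.succ)) ∧
      (∀ k, c k = ∑ m, b m * b k / (ev m.succ + ev k.succ)) := by
  obtain ⟨ev, hev0, hmono, hsp⟩ := S.exists_zeros hg
  have hspec : S.spectrum = Set.range (fun j => (ev j : ℂ)) := by
    ext lam
    rw [mem_spectrum_iff, hsp]
  have hzero : ∀ j, (S.endPoly 2).eval (-ev j) = 0 := fun j => by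
    have := (hsp (ev j)).2 ⟨j, rfl⟩
    rw [← Complex.ofReal_neg, leftState_ofReal] at this
    exact_mod_cast this
  have hwr : ∀ j, 0 < (S.endPoly 0).eval (-ev j) * (derivative (S.endPoly 2)).eval (-ev j) :=
    fun j => by simpa [hzero j] using S.wronskian_endPoly_pos hg (-ev j)
  have hevpos : ∀ k : Fin n, 0 < ev k.succ := fun k => hev0 ▸ hmono (Fin.succ_pos k)
  have hc : ∀ j, 0 < S.residue 0 (ev j) := fun j => by
    have h := hwr j
    rw [residue]
    rcases pos_and_pos_or_neg_and_neg_of_mul_pos h with ⟨h1, h2⟩ | ⟨h1, h2⟩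
    · exact div_pos h1 h2
    · exact div_pos_of_neg_of_neg h1 h2
  have hW : ∀ lam ∉ S.spectrum,
      S.weylW lam = ∑ k : Fin n, (S.residue 1 (ev k.succ) : ℂ) / (lam - ev k.succ) := by
    intro lam hlam
    rw [weylW_eq, S.neg_div_eq_sum_residue hg hmono.injective hsp
      (S.natDegree_endPoly_one_le hg) hlam, Fin.sum_univ_succ]
    -- The pole at `0` drops out because `φ₂(1)` vanishes at `lam = 0`.
    simp [hev0, residue, eval_zero_endPoly_one]
  have hZ : ∀ lam ∉ S.spectrum, S.weylZ lam =
      1 / (2 * lam) + ∑ k : Fin n, (S.residue 0 (ev k.succ) : ℂ) / (lam - ev k.succ) := by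
    intro lam hlam
    rw [weylZ_eq, S.neg_div_eq_sum_residue hg hmono.injective hsp
      (S.natDegree_endPoly_zero_le hg) hlam, Fin.sum_univ_succ]
    simp [hev0, residue, eval_zero_endPoly_zero, eval_zero_derivative_endPoly_two]
    ring
  -- At an eigenvalue one of the two `φ₃` terms in `leftState_neg` vanishes; dividing by the
  -- derivative of `endPoly 2` there relates the residues.
  have hrel : ∀ k : Fin n, S.residue 0 (ev k.succ) * (S.endPoly 2).eval (ev k.succ) =
      S.residue 1 (ev k.succ) * (S.endPoly 1).eval (ev k.succ) := fun k => by
    have h := S.leftState_neg (-ev k.succ) n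
    simp only [neg_neg, ← eval_endPoly, hzero, zero_mul, add_zero] at h
    rw [residue, residue, div_mul_eq_mul_div, div_mul_eq_mul_div, h]
  have hpos2 : ∀ k : Fin n, 0 < (S.endPoly 2).eval (ev k.succ) := fun k => by
    rw [eval_endPoly]
    exact (S.leftState_pos hg (hevpos k) n).2.2
  refine ⟨ev, fun k => S.residue 1 (ev k.succ), fun k => S.residue 0 (ev k.succ), hev0, hmono,
    hspec, fun j => ⟨?_, ?_⟩, fun k => ?_, fun k => hc _, hW, hZ, fun k => ?_⟩
  · rw [phi_one]
    exact (hsp _).2 ⟨j, rfl⟩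
  · rw [(S.hasDerivAt_phi _).deriv, neg_ne_zero, ← Complex.ofReal_neg]
    change aeval (algebraMap ℝ ℂ (-ev j)) _ ≠ 0
    rw [aeval_algebraMap_apply, coe_aeval_eq_eval]
    exact (map_ne_zero (algebraMap ℝ ℂ)).2 (right_ne_zero_of_mul (hwr j).ne')
  -- Positivity of `c_k` passes to `b_k` through `hrel`, where `φ₂` need only be nonnegative at
  -- `-λ_k`.
  · have h1 : 0 ≤ (S.endPoly 1).eval (ev k.succ) := by
      rw [eval_endPoly]
      exact (S.leftState_pos hg (hevpos k) n).2.1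
    have h := mul_pos (hc k.succ) (hpos2 k)
    rw [hrel] at h
    exact pos_of_mul_pos_left h h1
  -- The formula for `c_k` is `hrel` with `W` expanded at `-λ_k`, which is negative and so not an
  -- eigenvalue.
  · have hnot : (((-ev k.succ : ℝ)) : ℂ) ∉ S.spectrum := by
      rw [hspec]
      rintro ⟨j, hj⟩
      have h1 : ev j = -ev k.succ := Complex.ofReal_injective hj
      have h2 : ev 0 ≤ ev j := hmono.monotone (Fin.zero_le j)
      linarith [hevpos k]
    have h := hW _ hnot
    rw [weylW_eq, ← Complex.ofReal_neg, neg_neg, leftState_ofReal, leftState_ofReal] at h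
    have h' : -((S.endPoly 1).eval (ev k.succ) / (S.endPoly 2).eval (ev k.succ)) =
        ∑ m : Fin n, S.residue 1 (ev m.succ) / (-ev k.succ - ev m.succ) := by
      exact_mod_cast h
    have hck : S.residue 0 (ev k.succ) = S.residue 1 (ev k.succ) *
        ((S.endPoly 1).eval (ev k.succ) / (S.endPoly 2).eval (ev k.succ)) := by
      rw [← mul_div_assoc, ← hrel, mul_div_cancel_right₀ _ (hpos2 k).ne']
    beta_reduce
    rw [hck, ← neg_neg (_ / _ : ℝ), h', ← Finset.sum_neg_distrib, Finset.mul_sum]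
    refine Finset.sum_congr rfl fun m _ => ?_
    rw [← div_neg, mul_div_assoc', mul_comm]
    congr 1
    ring

lemma weylZ_eq_of_weylW_eq (hg : ∀ k, 0 < S.g k) {n' : ℕ} (S' : DualCubicString n')
    (hg' : ∀ k, 0 < S'.g k)
    (hW : ∀ lam, lam ∉ S.spectrum → lam ∉ S'.spectrum → S.weylW lam = S'.weylW lam) {lam : ℂ}
    (h : lam ∉ S.spectrum) (h' : lam ∉ S'.spectrum) : S.weylZ lam = S'.weylZ lam := by
  obtain ⟨ev, b, c, h0, hmono, hspec, -, -, -, -, hZ, -⟩ := S.exists_spectral_data hg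
  obtain ⟨ev', b', c', h0', hmono', hspec', -, -, -, -, hZ', -⟩ := S'.exists_spectral_data hg'
  have hdiff : ∀ lam, lam ∉ S.spectrum → lam ∉ S'.spectrum → S.weylZ lam - S'.weylZ lam =
      ∑ i : Fin n ⊕ Fin n', Sum.elim (fun k => (c k : ℂ)) (fun k => -(c' k : ℂ)) i /
        (lam - (Sum.elim (fun k => ev (Fin.succ k)) (fun k => ev' (Fin.succ k)) i : ℝ)) := by
    intro lam h h'
    rw [hZ lam h, hZ' lam h', Fintype.sum_sum_type]
    simp only [Sum.elim_inl, Sum.elim_inr, neg_div, Finset.sum_neg_distrib]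
    ring
  have hfin : (S.spectrum ∪ S'.spectrum).Finite := by
    rw [hspec, hspec']
    exact (finite_range _).union (finite_range _)
  rw [← sub_eq_zero, hdiff lam h h']
  -- The exceptional set is made symmetric so that the relation between `Z` and `W` applies at both
  -- `x` and `-x`.
  refine sum_div_eq_zero_of_odd ?_ (hfin.union (hfin.image Neg.neg)) ?_ ?_
  · rintro (k | k)
    · exact h0 ▸ hmono (Fin.succ_pos k)
    · exact h0' ▸ hmono' (Fin.succ_pos k)
  · intro x hx
    simp only [mem_union, mem_image, not_or, not_exists, not_and] at hx
    obtain ⟨⟨h1, h1'⟩, h2⟩ := hx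
    have h2n : -x ∉ S.spectrum := fun hm => h2 (-x) (Or.inl hm) (neg_neg x)
    have h2n' : -x ∉ S'.spectrum := fun hm => h2 (-x) (Or.inr hm) (neg_neg x)
    rw [← hdiff x h1 h1', ← hdiff (-x) h2n h2n']
    have e := S.weylZ_add_weylZ_neg h1 h2n
    rw [hW x h1 h1', hW (-x) h2n h2n'] at e
    linear_combination e - S'.weylZ_add_weylZ_neg h1' h2n'
  · rintro (k | k) rfl
    · exact h (by rw [hspec]; exact ⟨k.succ, rfl⟩)
    · exact h' (by rw [hspec']; exact ⟨k.succ, rfl⟩)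

end DualCubicString

theorem mainTheorem9 {n : ℕ} (S : DualCubicString n) (hg : ∀ k, 0 < S.g k) :
    -- the normalized solution exists and is unique (off the masses), for every `lam`
    (∀ lam : ℂ, S.IsNormalizedSolution lam (S.phi lam) ∧
      ∀ Φ, S.IsNormalizedSolution lam Φ →
        ∀ y ∈ Set.Icc (-1 : ℝ) 1, y ∉ Set.range S.y → Φ y = S.phi lam y) ∧
    (∃ (ev : Fin (n + 1) → ℝ) (b c : Fin n → ℝ),
      -- the spectrum is `0 = ev 0 < ev 1 < ⋯ < ev n`
      ev 0 = 0 ∧ StrictMono ev ∧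
      S.spectrum = Set.range (fun j => (ev j : ℂ)) ∧
      -- simplicity: one-dimensional eigenspaces, and simple zeros of `φ₃(1; lam)`
      (∀ j Φ, S.IsEigenfunction (ev j) Φ →
        ∃ a : ℂ, ∀ y ∈ Set.Icc (-1 : ℝ) 1, y ∉ Set.range S.y → Φ y = a • S.phi (ev j) y) ∧
      (∀ j, S.phi (ev j) 1 2 = 0 ∧ deriv (fun lam => S.phi lam 1 2) (ev j : ℂ) ≠ 0) ∧
      -- partial fractions of the Weyl functions, with positive residues
      (∀ k, 0 < b k) ∧ (∀ k, 0 < c k) ∧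
      (∀ lam ∉ S.spectrum, S.weylW lam = ∑ k, (b k : ℂ) / (lam - ev k.succ)) ∧
      (∀ lam ∉ S.spectrum,
        S.weylZ lam = 1 / (2 * lam) + ∑ k, (c k : ℂ) / (lam - ev k.succ)) ∧
      (∀ k, c k = ∑ m, b m * b k / (ev m.succ + ev k.succ))) ∧
    (∀ lam, lam ∉ S.spectrum → -lam ∉ S.spectrum →
      S.weylZ lam + S.weylZ (-lam) + S.weylW lam * S.weylW (-lam) = 0) ∧
    -- `Z` is determined by `W`
    (∀ (n' : ℕ) (S' : DualCubicString n'), (∀ k, 0 < S'.g k) →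
      (∀ lam, lam ∉ S.spectrum → lam ∉ S'.spectrum → S.weylW lam = S'.weylW lam) →
      ∀ lam, lam ∉ S.spectrum → lam ∉ S'.spectrum → S.weylZ lam = S'.weylZ lam) := by
  obtain ⟨ev, b, c, h0, hmono, hspec, hsimple, hb, hc, hW, hZ, hcb⟩ := S.exists_spectral_data hg
  exact ⟨fun lam => ⟨S.phi_isNormalized lam, fun Φ hΦ y hy hyS => hΦ.eq_phi hy hyS⟩,
    ⟨ev, b, c, h0, hmono, hspec, fun j Φ hΦ => ⟨_, fun y hy hyS => hΦ.eq_smul_phi hy hyS⟩,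
      hsimple, hb, hc, hW, hZ, hcb⟩,
    fun lam h h' => S.weylZ_add_weylZ_neg h h',
    fun n' S' hg' hWW lam h h' => S.weylZ_eq_of_weylW_eq hg S' hg' hWW h h'⟩
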